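/- Recall that, for a real Banach lattice $E$ with topological dual $E'$ (ordered by $f \le g$ iff $f(x) \le g(x)$ for all $x \ge 0$, and a Banach lattice for this order and the dual norm), a sequence $(f_n) \subset E'$ is disjoint if $|f_m| \wedge |f_n| = 0$ for $m \ne n$. The Banach lattice $E$ has property (d) if $|f_n| \to 0$ in the weak* topology for every disjoint weak* null sequence $(f_n) \subset E'$. A bounded set $A \subset E$ is almost limited if every disjoint weak* null sequence in $E'$ converges to zero uniformly on $A$; a sequence is almost limited if the set of its terms is. $E$ has the strong Gelfand–Phillips property if every almost limited subset of $E$ is relatively (norm) compact. A linear operator between Banach lattices is order bounded if it maps order bounded sets to order bounded sets. A linear operator $T : E \to Y$ into a Banach space is almost limited completely continuous (alcc) if it is bounded and $\|T x_n\| \to 0$ for every almost limited weakly null sequence $(x_n) \subset E$. Proposition. Let $E$ and $F$ be real Banach lattices with property (d), and let $T : E \to F$ be an order bounded linear operator. If $F$ has the strong Gelfand–Phillips property, then $T$ is an alcc operator (in particular, $T$ is bounded). -/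

import Mathlib

open Filter Topology

noncomputable section

namespace BanachLattice

section Dual

variable {E : Type*} [NormedAddCommGroup E] [NormedSpace ℝ E] [Lattice E] [HasSolidNorm E]
  [IsOrderedAddMonoid E]

/-- For a continuous functional `h` and `x ≥ 0`, the number `sup {h u : 0 ≤ u ≤ x}`. -/
def supIcc (h : StrongDual ℝ E) (x : E) : ℝ := sSup (h '' Set.Icc 0 x)

theorem apply_le_of_mem_Icc (h : StrongDual ℝ E) {x u : E} (hu : u ∈ Set.Icc 0 x) :
    h u ≤ ‖h‖ * ‖x‖ := by
  have h1 : ‖u‖ ≤ ‖x‖ := norm_le_norm_of_abs_le_abs (by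
    rw [abs_of_nonneg hu.1, abs_of_nonneg (hu.1.trans hu.2)]; exact hu.2)
  calc h u ≤ ‖h u‖ := le_abs_self _
    _ ≤ ‖h‖ * ‖u‖ := h.le_opNorm u
    _ ≤ ‖h‖ * ‖x‖ := by gcongr

theorem bddAbove_image_Icc (h : StrongDual ℝ E) (x : E) : BddAbove (h '' Set.Icc 0 x) := by
  refine ⟨‖h‖ * ‖x‖, ?_⟩
  rintro _ ⟨u, hu, rfl⟩
  exact apply_le_of_mem_Icc h hu

theorem le_supIcc (h : StrongDual ℝ E) {x u : E} (h0 : 0 ≤ u) (hu : u ≤ x) :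
    h u ≤ supIcc h x :=
  le_csSup (bddAbove_image_Icc h x) ⟨u, ⟨h0, hu⟩, rfl⟩

theorem supIcc_le (h : StrongDual ℝ E) {x : E} (hx : 0 ≤ x) {c : ℝ}
    (hc : ∀ u, 0 ≤ u → u ≤ x → h u ≤ c) : supIcc h x ≤ c := by
  refine csSup_le ⟨_, 0, ⟨le_rfl, hx⟩, rfl⟩ ?_
  rintro _ ⟨u, hu, rfl⟩
  exact hc u hu.1 hu.2

theorem supIcc_nonneg (h : StrongDual ℝ E) {x : E} (hx : 0 ≤ x) : 0 ≤ supIcc h x := by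
  simpa using le_supIcc h le_rfl hx

theorem supIcc_add (h : StrongDual ℝ E) {x y : E} (hx : 0 ≤ x) (hy : 0 ≤ y) :
    supIcc h (x + y) = supIcc h x + supIcc h y := by
  apply le_antisymm
  · refine supIcc_le h (add_nonneg hx hy) fun u hu huxy => ?_
    have e : h u = h (u ⊓ x) + h (u - u ⊓ x) := by rw [← map_add]; congr 1; abel
    rw [e]
    refine add_le_add (le_supIcc h (le_inf hu hx) inf_le_right)
      (le_supIcc h (sub_nonneg.2 inf_le_left) ?_)
    rw [sub_le_comm]
    exact le_inf (sub_le_self u hy) (sub_le_iff_le_add.2 huxy)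
  · rw [← le_sub_iff_add_le]
    refine supIcc_le h hx fun u hu hux => ?_
    rw [le_sub_comm]
    refine supIcc_le h hy fun v hv hvy => ?_
    rw [le_sub_iff_add_le', ← map_add]
    exact le_supIcc h (add_nonneg hu hv) (add_le_add hux hvy)

theorem supIcc_sub_eq (h : StrongDual ℝ E) {a b c d : E} (ha : 0 ≤ a) (hb : 0 ≤ b) (hc : 0 ≤ c)
    (hd : 0 ≤ d) (e : a - b = c - d) :
    supIcc h a - supIcc h b = supIcc h c - supIcc h d := by
  have e' : a + d = c + b := sub_eq_sub_iff_add_eq_add.1 e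
  have := congrArg (supIcc h) e'
  rw [supIcc_add h ha hd, supIcc_add h hc hb] at this
  linarith

/-- The positive part of a continuous functional as an additive map: the additive extension to `E`
of `x ↦ sup {h u : 0 ≤ u ≤ x}`. -/
def posAddHom (h : StrongDual ℝ E) : E →+ ℝ :=
  AddMonoidHom.mk' (fun x => supIcc h x⁺ - supIcc h x⁻) (by
    intro x y
    have h1 := supIcc_sub_eq h (posPart_nonneg (x + y)) (negPart_nonneg (x + y))
      (add_nonneg (posPart_nonneg x) (posPart_nonneg y))
      (add_nonneg (negPart_nonneg x) (negPart_nonneg y))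
      (by rw [posPart_sub_negPart, add_sub_add_comm, posPart_sub_negPart, posPart_sub_negPart])
    rw [h1, supIcc_add h (posPart_nonneg x) (posPart_nonneg y),
      supIcc_add h (negPart_nonneg x) (negPart_nonneg y)]
    ring)

theorem posAddHom_of_nonneg (h : StrongDual ℝ E) {x : E} (hx : 0 ≤ x) :
    posAddHom h x = supIcc h x := by
  change supIcc h x⁺ - supIcc h x⁻ = supIcc h x
  have : supIcc h (0 : E) = 0 := by
    have := supIcc_add h (le_refl (0 : E)) (le_refl (0 : E))
    rw [add_zero] at this
    linarith
  rw [posPart_of_nonneg hx, negPart_of_nonneg hx, this, sub_zero]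

theorem norm_posAddHom_le (h : StrongDual ℝ E) (x : E) : ‖posAddHom h x‖ ≤ ‖h‖ * ‖x‖ := by
  have key : ∀ y : E, 0 ≤ y → y ≤ |x| → supIcc h y ≤ ‖h‖ * ‖x‖ := fun y h0 hy =>
    supIcc_le h h0 fun u hu huy => by
      simpa [norm_abs_eq_norm] using apply_le_of_mem_Icc h (x := |x|) ⟨hu, huy.trans hy⟩
  have h1 := key x⁺ (posPart_nonneg x) (sup_le (le_abs_self x) (abs_nonneg x))
  have h2 := key x⁻ (negPart_nonneg x) (sup_le (neg_le_abs x) (abs_nonneg x))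
  have h3 := supIcc_nonneg h (posPart_nonneg x)
  have h4 := supIcc_nonneg h (negPart_nonneg x)
  change |supIcc h x⁺ - supIcc h x⁻| ≤ _
  rw [abs_le]
  constructor <;> linarith

/-- The positive part `h⁺` of a continuous functional `h`, determined by
`h⁺ x = sup {h u : 0 ≤ u ≤ x}` for `x ≥ 0`. -/
def dualPos (h : StrongDual ℝ E) : StrongDual ℝ E :=
  (posAddHom h).toRealLinearMap
    (AddMonoidHomClass.continuous_of_bound (posAddHom h) ‖h‖ (norm_posAddHom_le h))

theorem dualPos_of_nonneg (h : StrongDual ℝ E) {x : E} (hx : 0 ≤ x) :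
    dualPos h x = supIcc h x := posAddHom_of_nonneg h hx

/-- The order of the dual `E'`: `f ≤ g` means that `f x ≤ g x` for all `x ≥ 0`. -/
instance dualPartialOrder : PartialOrder (StrongDual ℝ E) where
  le f g := ∀ x : E, 0 ≤ x → f x ≤ g x
  le_refl _ _ _ := le_rfl
  le_trans _ _ _ h1 h2 x hx := (h1 x hx).trans (h2 x hx)
  le_antisymm f g h1 h2 := by
    have key : ∀ x : E, 0 ≤ x → f x = g x := fun x hx => le_antisymm (h1 x hx) (h2 x hx)
    ext x
    rw [← posPart_sub_negPart x, map_sub, map_sub, key _ (posPart_nonneg x),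
      key _ (negPart_nonneg x)]

/-- The dual `E'` is a lattice for its order; its modulus `|f| = f ⊔ -f` and its meet `⊓`
are those of the dual Banach lattice. -/
instance dualLattice : Lattice (StrongDual ℝ E) where
  toPartialOrder := dualPartialOrder
  sup f g := g + dualPos (f - g)
  inf f g := f - dualPos (f - g)
  le_sup_left f g x hx := by
    have := le_supIcc (f - g) hx le_rfl
    rw [add_apply, dualPos_of_nonneg _ hx]
    rw [sub_apply] at this
    linarith
  le_sup_right f g x hx := by
    have := supIcc_nonneg (f - g) hx
    rw [add_apply, dualPos_of_nonneg _ hx]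
    linarith
  sup_le f g k hf hg x hx := by
    rw [add_apply, dualPos_of_nonneg _ hx]
    have : supIcc (f - g) x ≤ k x - g x := supIcc_le _ hx fun u hu hux => by
      have h1 := hf u hu
      have h2 := hg (x - u) (sub_nonneg.2 hux)
      rw [map_sub, map_sub] at h2
      rw [sub_apply]
      linarith
    linarith
  inf_le_left f g x hx := by
    have := supIcc_nonneg (f - g) hx
    rw [sub_apply, dualPos_of_nonneg _ hx]
    linarith
  inf_le_right f g x hx := by
    have := le_supIcc (f - g) hx le_rfl
    rw [sub_apply, dualPos_of_nonneg _ hx]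
    rw [sub_apply] at this
    linarith
  le_inf k f g hf hg x hx := by
    rw [sub_apply, dualPos_of_nonneg _ hx]
    have : supIcc (f - g) x ≤ f x - k x := supIcc_le _ hx fun u hu hux => by
      have h1 := hg u hu
      have h2 := hf (x - u) (sub_nonneg.2 hux)
      rw [map_sub, map_sub] at h2
      rw [sub_apply]
      linarith
    linarith

/-- A sequence of functionals that is pairwise disjoint in the lattice `E'`. -/
def DisjointSeq (f : ℕ → StrongDual ℝ E) : Prop :=
  Pairwise fun m n => |f m| ⊓ |f n| = 0

/-- A sequence of functionals that converges to zero in the weak* topology. -/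
def WeakStarNull (f : ℕ → StrongDual ℝ E) : Prop :=
  Tendsto (fun n => StrongDual.toWeakDual (f n)) atTop (𝓝 0)

end Dual

/-- A sequence of vectors that converges to zero in the weak topology. -/
def WeaklyNull {E : Type*} [NormedAddCommGroup E] [NormedSpace ℝ E] (x : ℕ → E) : Prop :=
  Tendsto (fun n => toWeakSpace ℝ E (x n)) atTop (𝓝 0)

section Properties

variable (E : Type*) [NormedAddCommGroup E] [NormedSpace ℝ E] [Lattice E] [HasSolidNorm E]
  [IsOrderedAddMonoid E]

/-- Property (d): `|f n| → 0` weak* for every disjoint weak* null sequence `f` in `E'`. -/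
def PropertyD : Prop :=
  ∀ f : ℕ → StrongDual ℝ E, DisjointSeq f → WeakStarNull f → WeakStarNull fun n => |f n|

variable {E} in
/-- An almost limited set: a bounded set on which every disjoint weak* null sequence in `E'`
converges uniformly to zero. -/
def AlmostLimited (A : Set E) : Prop :=
  Bornology.IsBounded A ∧
    ∀ f : ℕ → StrongDual ℝ E, DisjointSeq f → WeakStarNull f →
      TendstoUniformlyOn (fun n x => f n x) 0 atTop A

/-- The strong Gelfand-Phillips property: almost limited sets are relatively compact. -/
def StrongGelfandPhillips : Prop :=
  ∀ A : Set E, AlmostLimited A → IsCompact (closure A)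

end Properties

/-- A linear operator that maps order bounded sets to order bounded sets. -/
def OrderBounded {E F : Type*} [AddCommGroup E] [Module ℝ E] [Preorder E]
    [AddCommGroup F] [Module ℝ F] [Preorder F] (T : E →ₗ[ℝ] F) : Prop :=
  ∀ A : Set E, BddBelow A ∧ BddAbove A → BddBelow (T '' A) ∧ BddAbove (T '' A)

/-- An almost limited completely continuous operator: a bounded linear operator that maps almost
limited weakly null sequences to norm null sequences. -/
def Alcc {E Y : Type*} [NormedAddCommGroup E] [NormedSpace ℝ E] [Lattice E] [HasSolidNorm E]
    [IsOrderedAddMonoid E] [NormedAddCommGroup Y] [NormedSpace ℝ Y] (T : E →ₗ[ℝ] Y) : Prop :=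
  Continuous T ∧
    ∀ x : ℕ → E, AlmostLimited (Set.range x) → WeaklyNull x →
      Tendsto (fun n => T (x n)) atTop (𝓝 0)

end BanachLattice

end

namespace BanachLattice

/-! ### Order and weak* convergence in the dual. -/

section DualOrder

variable {E : Type*} [NormedAddCommGroup E] [NormedSpace ℝ E] [Lattice E] [HasSolidNorm E]
  [IsOrderedAddMonoid E]

/-! It suffices that `T` preserves almost limited sets (`AlmostLimited.image`): then `T (x n)` is
weakly null with relatively compact range, hence norm null.

For a disjoint weak* null `f n` in `F'`, property (d) of `F` makes `|f n|` weak* null. Since `T`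
sends `[-x, x]` below some `b` in modulus, `(f n ∘ T)⁺ x ≤ |f n| b`, so the positive and negative
parts of `f n ∘ T` are weak* null. They need not be disjoint; the crux is that positive weak* null
sequences still converge uniformly on almost limited sets
(`AlmostLimited.tendstoUniformlyOn_of_nonneg`), by passing to a subsequence and disjointifying it
(`exists_disjointSeq_le`). -/

instance dualIsOrderedAddMonoid : IsOrderedAddMonoid (StrongDual ℝ E) where
  add_le_add_left f g h k x hx := by
    have := h x hx
    simp only [add_apply]
    linarith

theorem dual_smul_nonneg {c : ℝ} (hc : 0 ≤ c) {f : StrongDual ℝ E} (hf : 0 ≤ f) : 0 ≤ c • f :=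
  fun x hx => mul_nonneg hc (hf x hx)

theorem dual_posPart_apply (f : StrongDual ℝ E) {x : E} (hx : 0 ≤ x) : f⁺ x = supIcc f x := by
  change (0 + dualPos (f - 0) : StrongDual ℝ E) x = _
  rw [zero_add, sub_zero, dualPos_of_nonneg f hx]

theorem weakStarNull_iff {f : ℕ → StrongDual ℝ E} :
    WeakStarNull f ↔ ∀ x, Tendsto (fun n => f n x) atTop (𝓝 0) :=
  tendsto_iff_forall_eval_tendsto_topDualPairing

/-- For positive functionals, weak* convergence to zero may be tested on the positive cone. -/
theorem weakStarNull_of_nonneg {f : ℕ → StrongDual ℝ E}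
    (h : ∀ x, 0 ≤ x → Tendsto (fun n => f n x) atTop (𝓝 0)) : WeakStarNull f := by
  refine weakStarNull_iff.2 fun x => ?_
  have := (h _ (posPart_nonneg x)).sub (h _ (negPart_nonneg x))
  simpa only [← map_sub, posPart_sub_negPart, sub_zero] using this

theorem abs_apply_le {f : StrongDual ℝ E} (hf : 0 ≤ f) (x : E) : |f x| ≤ f |x| := by
  have h1 := hf _ (sub_nonneg.2 (le_abs_self x))
  have h2 := hf _ (sub_nonneg.2 (neg_le_abs x))
  simp only [map_sub, map_neg, zero_apply] at h1 h2
  rw [abs_le]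
  constructor <;> linarith

theorem dual_apply_le_abs_apply (f : StrongDual ℝ E) (u : E) : f u ≤ |f| |u| := by
  have h1 := le_abs_self f _ (posPart_nonneg u)
  have h2 := neg_le_abs f _ (negPart_nonneg u)
  have h3 : f u = f u⁺ - f u⁻ := by rw [← map_sub, posPart_sub_negPart]
  have h4 : |f| |u| = |f| u⁺ + |f| u⁻ := by rw [← map_add, posPart_add_negPart]
  rw [neg_apply] at h2
  linarith

/-- As `b - c⁻¹ a = -c⁻¹ (a - c b)`, the second factor is `c⁻¹ (a - c b)⁻`, and `c ≥ 1` puts it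
below `(a - c b)⁻`. -/
theorem posPart_sub_smul_inf_posPart_sub_smul (a b : StrongDual ℝ E) {c : ℝ} (hc : 1 ≤ c) :
    (a - c • b)⁺ ⊓ (b - c⁻¹ • a)⁺ = 0 := by
  have hc0 : 0 < c := by linarith
  refine le_antisymm ?_ (le_inf (posPart_nonneg _) (posPart_nonneg _))
  rw [← posPart_inf_negPart_eq_zero (a - c • b)]
  refine inf_le_inf_left _ (sup_le (fun x hx => ?_) (negPart_nonneg _))
  have h1 := neg_le_negPart (a - c • b) x hx
  have h2 := negPart_nonneg (a - c • b) x hx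
  simp only [neg_apply, sub_apply, smul_apply, smul_eq_mul, zero_apply] at h1 h2 ⊢
  have h3 : b x - c⁻¹ * a x = c⁻¹ * (-(a x - c * b x)) := by field_simp; ring
  rw [h3]
  calc c⁻¹ * (-(a x - c * b x)) ≤ c⁻¹ * (a - c • b)⁻ x := by gcongr
    _ ≤ 1 * (a - c • b)⁻ x := by
      gcongr
      exact inv_le_one_of_one_le₀ hc
    _ = _ := one_mul _

/-! ### Disjointification of positive functionals. -/

/-- A decreasing sequence of positive functionals converges pointwise. -/
theorem exists_tendsto_of_antitone_nonneg [CompleteSpace E] {q : ℕ → StrongDual ℝ E}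
    (hq : Antitone q) (h0 : ∀ n, 0 ≤ q n) :
    ∃ p : StrongDual ℝ E, ∀ x, Tendsto (fun n => q n x) atTop (𝓝 (p x)) := by
  have key : ∀ x : E, 0 ≤ x → ∃ l, Tendsto (fun n => q n x) atTop (𝓝 l) := fun x hx =>
    ⟨_, tendsto_atTop_ciInf (fun m n hmn => hq hmn x hx)
      ⟨0, by rintro _ ⟨n, rfl⟩; exact h0 n x hx⟩⟩
  have key' : ∀ x : E, ∃ l, Tendsto (fun n => q n x) atTop (𝓝 l) := fun x => by
    obtain ⟨l, hl⟩ := key _ (posPart_nonneg x)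
    obtain ⟨m, hm⟩ := key _ (negPart_nonneg x)
    refine ⟨l - m, ?_⟩
    have := hl.sub hm
    simpa only [← map_sub, posPart_sub_negPart] using this
  choose l hl using key'
  exact ⟨continuousLinearMapOfTendsto q (tendsto_pi_nhds.2 hl), hl⟩

/-- Positive functionals `h n` that are small on the earlier vectors `x i`, `i < n`, can be
replaced by disjoint smaller ones, with control of the error at `x n`. -/
theorem exists_disjointSeq_le [CompleteSpace E] {h : ℕ → StrongDual ℝ E} (h0 : ∀ n, 0 ≤ h n)
    {x : ℕ → E} {δ : ℝ} (hx : ∀ i j, i < j → 4 ^ j * h j |x i| ≤ δ) :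
    ∃ p : ℕ → StrongDual ℝ E, DisjointSeq p ∧ (∀ n, 0 ≤ p n ∧ p n ≤ h n) ∧
      ∀ n, (h n - p n) |x n| ≤ δ + (2 ^ n)⁻¹ * ∑ i ∈ Finset.range n, h i |x n| := by
  -- The weights match the pair `h m - 2 ^ n • h n`, `h n - (2 ^ n)⁻¹ • h m` for `m < n`. The first
  -- sum is cut at `M` because the full series need not converge; the positive parts decrease in `M`
  -- and still have a limit `p n`.
  let r : ℕ → ℕ → StrongDual ℝ E := fun n M =>
    (∑ m ∈ Finset.Ioc n M, (2 : ℝ) ^ m • h m) + ((2 : ℝ) ^ n)⁻¹ • ∑ i ∈ Finset.range n, h i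
  let q : ℕ → ℕ → StrongDual ℝ E := fun n M => (h n - r n M)⁺
  have hterm : ∀ m, 0 ≤ (2 : ℝ) ^ m • h m := fun m => dual_smul_nonneg (by positivity) (h0 m)
  have hlow : ∀ n, 0 ≤ ((2 : ℝ) ^ n)⁻¹ • ∑ i ∈ Finset.range n, h i := fun n =>
    dual_smul_nonneg (by positivity) (Finset.sum_nonneg fun i _ => h0 i)
  have hr0 : ∀ n M, 0 ≤ r n M := fun n M =>
    add_nonneg (Finset.sum_nonneg fun m _ => hterm m) (hlow n)
  have hr : ∀ n, Monotone (r n) := fun n M N hMN =>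
    add_le_add_left (Finset.sum_le_sum_of_subset_of_nonneg
      (Finset.Ioc_subset_Ioc_right hMN) fun m _ _ => hterm m) _
  have hq : ∀ n, Antitone (q n) := fun n M N hMN =>
    sup_le_sup_right (sub_le_sub_left (hr n hMN) _) _
  choose p hp using fun n => exists_tendsto_of_antitone_nonneg (hq n) fun M => posPart_nonneg _
  have hpq : ∀ n M, p n ≤ q n M := fun n M y hy =>
    le_of_tendsto (hp n y) ((eventually_ge_atTop M).mono fun N hN => hq n hN y hy)
  have hp0 : ∀ n, 0 ≤ p n := fun n y hy =>
    ge_of_tendsto' (hp n y) fun N => posPart_nonneg (h n - r n N) y hy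
  have hpair : ∀ m n, m < n → p m ⊓ p n = 0 := by
    intro m n hmn
    refine le_antisymm ?_ (le_inf (hp0 m) (hp0 n))
    rw [← posPart_sub_smul_inf_posPart_sub_smul (h m) (h n)
      (one_le_pow₀ (one_le_two : (1 : ℝ) ≤ 2) : (1 : ℝ) ≤ 2 ^ n)]
    -- Cut at `M = n`: `r m n` contains `2 ^ n • h n`, and `r n n` contains `(2 ^ n)⁻¹ • h m`.
    refine inf_le_inf ((hpq m n).trans (posPart_mono (sub_le_sub_left ?_ _)))
      ((hpq n n).trans (posPart_mono (sub_le_sub_left ?_ _)))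
    · exact (Finset.single_le_sum (f := fun k => (2 : ℝ) ^ k • h k) (fun k _ => hterm k)
        (Finset.mem_Ioc.2 ⟨hmn, le_rfl⟩)).trans (le_add_of_nonneg_right (hlow m))
    · refine le_trans (fun y hy => ?_) (le_add_of_nonneg_left (Finset.sum_nonneg fun k _ => hterm k))
      have := Finset.single_le_sum (fun k _ => h0 k) (Finset.mem_range.2 hmn) y hy
      simp only [smul_apply, smul_eq_mul]
      gcongr
  refine ⟨p, fun m n hmn => ?_, fun n => ⟨hp0 n, ?_⟩, fun n => ?_⟩
  · change |p m| ⊓ |p n| = 0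
    rw [abs_of_nonneg (hp0 m), abs_of_nonneg (hp0 n)]
    rcases lt_or_gt_of_ne hmn with hlt | hlt
    · exact hpair m n hlt
    · rw [inf_comm]
      exact hpair n m hlt
  · exact (hpq n 0).trans (sup_le (sub_le_self _ (hr0 n 0)) (h0 n))
  · refine le_of_tendsto' ((hp n |x n|).const_sub (h n |x n|)) fun M => ?_
    have h1 := le_posPart (h n - r n M) _ (abs_nonneg (x n))
    have h2 : r n M |x n| ≤ δ + (2 ^ n)⁻¹ * ∑ i ∈ Finset.range n, h i |x n| := by
      simp only [r, add_apply, smul_apply, smul_eq_mul, sum_apply]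
      gcongr
      have hδ : 0 ≤ δ := (mul_nonneg (by positivity) (h0 (n + 1) _ (abs_nonneg (x n)))).trans
        (hx n (n + 1) n.lt_succ_self)
      have hsum : ∀ N, ∑ m ∈ Finset.Ioc n N, ((2 : ℝ) ^ m)⁻¹ ≤ 1 := fun N => by
        calc ∑ m ∈ Finset.Ioc n N, ((2 : ℝ) ^ m)⁻¹
            ≤ ∑ m ∈ Finset.Ioc 0 N, ((2 : ℝ) ^ m)⁻¹ :=
              Finset.sum_le_sum_of_subset_of_nonneg (Finset.Ioc_subset_Ioc_left (Nat.zero_le n))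
                fun _ _ _ => by positivity
          _ = 1 - (2 ^ N)⁻¹ := by
              induction N with
              | zero => simp
              | succ k ih =>
                rw [Finset.sum_Ioc_succ_top (Nat.zero_le k), ih, pow_succ]
                field_simp
                ring
          _ ≤ 1 := sub_le_self _ (by positivity)
      -- The factor `4 ^ m` in `hx` absorbs the weight `2 ^ m` and leaves a geometric series.
      calc ∑ m ∈ Finset.Ioc n M, 2 ^ m * h m |x n|
          ≤ ∑ m ∈ Finset.Ioc n M, (2 ^ m)⁻¹ * δ := Finset.sum_le_sum fun m hm => by
            have h3 := hx n m (Finset.mem_Ioc.1 hm).1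
            have h4 : (4 : ℝ) ^ m = 2 ^ m * 2 ^ m := by rw [← mul_pow]; norm_num
            rw [inv_mul_eq_div, le_div_iff₀ (by positivity)]
            calc _ = 4 ^ m * h m |x n| := by rw [h4]; ring
              _ ≤ δ := h3
        _ = (∑ m ∈ Finset.Ioc n M, ((2 : ℝ) ^ m)⁻¹) * δ := by rw [Finset.sum_mul]
        _ ≤ 1 * δ := mul_le_mul_of_nonneg_right (hsum M) hδ
        _ = δ := one_mul δ
    rw [sub_apply] at h1
    linarith

/-- Choice of a subsequence along which positive weak* null functionals are small on the
earlier vectors. -/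
theorem exists_strictMono_apply_le {h : ℕ → StrongDual ℝ E} (h0 : ∀ n, 0 ≤ h n)
    (hw : WeakStarNull h) (x : ℕ → E) {δ : ℝ} (hδ : 0 < δ) :
    ∃ φ : ℕ → ℕ, StrictMono φ ∧ ∀ i j, i < j → 4 ^ j * h (φ j) |x (φ i)| ≤ δ := by
  -- The recursion sees only the finite set of earlier values, not the index `j`. The first
  -- coordinate is a strictly increasing counter, so it is at least `j`.
  obtain ⟨f, -, hf⟩ := exists_seq_of_forall_finset_exists (α := ℕ × ℕ) (fun _ => True)
    (fun a b => a.1 < b.1 ∧ a.2 < b.2 ∧ 4 ^ b.1 * h b.2 |x a.2| ≤ δ) (by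
      intro s _
      obtain ⟨k, hk⟩ : ∃ k, ∀ a ∈ s, a.1 < k :=
        ⟨s.sup Prod.fst + 1, fun a ha => Nat.lt_succ_of_le (Finset.le_sup (f := Prod.fst) ha)⟩
      have h1 : ∀ᶠ n in atTop, ∀ a ∈ s, a.2 < n ∧ 4 ^ k * h n |x a.2| ≤ δ := by
        refine (Finset.eventually_all s).2 fun a _ => (eventually_gt_atTop a.2).and ?_
        have := (weakStarNull_iff.1 hw |x a.2|).const_mul ((4 : ℝ) ^ k)
        rw [mul_zero] at this
        exact this.eventually_le_const hδ
      obtain ⟨n, hn⟩ := h1.exists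
      exact ⟨(k, n), trivial, fun a ha => ⟨hk a ha, hn a ha⟩⟩)
  have hmono : StrictMono fun n => (f n).1 := fun m n hmn => (hf m n hmn).1
  refine ⟨fun n => (f n).2, fun m n hmn => (hf m n hmn).2.1, fun i j hij => ?_⟩
  refine le_trans ?_ (hf i j hij).2.2
  have := h0 (f j).2 _ (abs_nonneg (x (f i).2))
  rw [zero_apply] at this
  gcongr
  · norm_num
  · exact hmono.id_le j

/-- Positive weak* null sequences converge to zero uniformly on almost limited sets. -/
theorem AlmostLimited.tendstoUniformlyOn_of_nonneg [CompleteSpace E] {A : Set E}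
    (hA : AlmostLimited A) {g : ℕ → StrongDual ℝ E} (g0 : ∀ n, 0 ≤ g n) (hg : WeakStarNull g) :
    TendstoUniformlyOn (fun n x => g n x) 0 atTop A := by
  rw [Metric.tendstoUniformlyOn_iff]
  by_contra! hcon
  obtain ⟨ε, hε, hcon⟩ := hcon
  obtain ⟨ψ, hψ, hbad⟩ := extraction_of_frequently_atTop (not_eventually.1 hcon)
  push Not at hbad
  choose a haA ha using hbad
  have hgψ : WeakStarNull fun n => g (ψ n) :=
    weakStarNull_iff.2 fun x => (weakStarNull_iff.1 hg x).comp hψ.tendsto_atTop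
  obtain ⟨φ, hφ, hsmall⟩ := exists_strictMono_apply_le (fun n => g0 (ψ n)) hgψ a
    (show 0 < ε / 4 by positivity)
  obtain ⟨p, hdisj, hp, herr⟩ := exists_disjointSeq_le (h := fun n => g (ψ (φ n)))
    (x := fun n => a (φ n)) (fun n => g0 _) hsmall
  have hgφ := fun x => (weakStarNull_iff.1 hgψ x).comp hφ.tendsto_atTop
  have hpw : WeakStarNull p := weakStarNull_of_nonneg fun x hx =>
    squeeze_zero (fun n => (hp n).1 x hx) (fun n => (hp n).2 x hx) (hgφ x)
  obtain ⟨K, hK⟩ := hA.1.exists_norm_le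
  -- A uniform norm bound makes the sum over earlier functionals at most `n * (M * K)`, which the
  -- factor `2⁻ⁿ` defeats.
  obtain ⟨M, hM⟩ := banach_steinhaus (g := g) fun x => by
    obtain ⟨C, hC⟩ := (weakStarNull_iff.1 hg x).norm.bddAbove_range
    exact ⟨C, fun n => hC ⟨n, rfl⟩⟩
  have hlim : Tendsto (fun n : ℕ => (n : ℝ) * (1 / 2) ^ n * (M * K)) atTop (𝓝 0) := by
    simpa using (tendsto_self_mul_const_pow_of_lt_one (r := (1 / 2 : ℝ)) (by norm_num)
      (by norm_num)).mul_const (M * K)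
  have hunif := Metric.tendstoUniformlyOn_iff.1 (hA.2 p hdisj hpw) (ε / 4) (by positivity)
  obtain ⟨n, hn1, hn2⟩ :=
    ((hlim.eventually_lt_const (show 0 < ε / 4 by positivity)).and hunif).exists
  have h1 := ha (φ n)
  have h2 := hn2 _ (haA (φ n))
  have h3 := abs_apply_le (sub_nonneg.2 (hp n).2) (a (φ n))
  have h4 := herr n
  have h5 : ∑ i ∈ Finset.range n, g (ψ (φ i)) |a (φ n)| ≤ n * (M * K) := by
    refine (Finset.sum_le_card_nsmul _ _ (M * K) fun i _ => ?_).trans_eq (by simp)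
    calc g (ψ (φ i)) |a (φ n)| ≤ ‖g (ψ (φ i)) |a (φ n)|‖ := le_abs_self _
      _ ≤ ‖g (ψ (φ i))‖ * ‖|a (φ n)|‖ := (g (ψ (φ i))).le_opNorm _
      _ ≤ M * K := by
        rw [norm_abs_eq_norm]
        exact mul_le_mul (hM _) (hK _ (haA _)) (norm_nonneg _) ((norm_nonneg _).trans (hM 0))
  have h6 : ((2 : ℝ) ^ n)⁻¹ * ∑ i ∈ Finset.range n, g (ψ (φ i)) |a (φ n)|
      ≤ n * (1 / 2) ^ n * (M * K) := by
    calc _ ≤ ((2 : ℝ) ^ n)⁻¹ * (n * (M * K)) := by gcongr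
      _ = _ := by rw [one_div, inv_pow]; ring
  simp only [Pi.zero_apply, dist_zero_left, Real.norm_eq_abs, sub_apply] at h1 h2 h3 h4
  -- The value is at least `ε`, yet `p n` and the two error terms contribute less than `ε / 4` each,
  -- or at most that.
  have h7 := abs_sub_abs_le_abs_sub (g (ψ (φ n)) (a (φ n))) (p n (a (φ n)))
  linarith

end DualOrder

/-! ### Order bounded operators. -/

section Operators

variable {E F : Type*} [NormedAddCommGroup E] [NormedSpace ℝ E] [Lattice E] [HasSolidNorm E]
  [IsOrderedAddMonoid E] [NormedAddCommGroup F] [NormedSpace ℝ F] [Lattice F] [HasSolidNorm F]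
  [IsOrderedAddMonoid F]

theorem OrderBounded.exists_abs_apply_le {T : E →ₗ[ℝ] F} (hT : OrderBounded T) (x : E) :
    ∃ b : F, 0 ≤ b ∧ ∀ u, |u| ≤ x → |T u| ≤ b := by
  obtain ⟨⟨l, hl⟩, ⟨c, hc⟩⟩ := hT (Set.Icc (-x) x) ⟨bddBelow_Icc, bddAbove_Icc⟩
  refine ⟨|l| + |c|, add_nonneg (abs_nonneg l) (abs_nonneg c), fun u hu => ?_⟩
  have hmem : T u ∈ T '' Set.Icc (-x) x := ⟨u, ⟨neg_le.1 (abs_le'.1 hu).2, (abs_le'.1 hu).1⟩, rfl⟩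
  refine abs_le'.2 ⟨?_, ?_⟩
  · exact ((hc hmem).trans (le_abs_self c)).trans (le_add_of_nonneg_left (abs_nonneg l))
  · exact ((neg_le_neg (hl hmem)).trans (neg_le_abs l)).trans
      (le_add_of_nonneg_right (abs_nonneg c))

/-- Order bounded operators on Banach lattices are continuous. -/
theorem OrderBounded.continuous [CompleteSpace E] {T : E →ₗ[ℝ] F} (hT : OrderBounded T) :
    Continuous T := by
  by_contra hcon
  have hy : ∀ n : ℕ, ∃ y : E, ‖y‖ ≤ (1 / 2) ^ n ∧ n < ‖T y‖ := by
    intro n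
    by_contra! hn
    refine hcon (AddMonoidHomClass.continuous_of_bound T (2 ^ n * n) fun x => ?_)
    rcases eq_or_ne x 0 with rfl | hx
    · simp
    have hx' : 0 < ‖x‖ := norm_pos_iff.2 hx
    have h1 := hn (((1 / 2) ^ n * ‖x‖⁻¹ : ℝ) • x) (by
      rw [norm_smul, Real.norm_of_nonneg (by positivity), mul_assoc, inv_mul_cancel₀ hx'.ne',
        mul_one])
    rw [map_smul, norm_smul, Real.norm_of_nonneg (by positivity)] at h1
    calc ‖T x‖ = 2 ^ n * ‖x‖ * ((1 / 2) ^ n * ‖x‖⁻¹ * ‖T x‖) := by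
          rw [one_div, inv_pow]; field_simp
      _ ≤ 2 ^ n * ‖x‖ * n := by gcongr
      _ = _ := by ring
  choose y hy1 hy2 using hy
  -- Completeness gives one upper bound `∑' |y n|` for all `|y n|`, so all `T (y n)` lie in one
  -- order bounded, hence norm bounded, set.
  have hs : Summable fun n => |y n| := by
    refine Summable.of_norm_bounded summable_geometric_two fun n => ?_
    rw [norm_abs_eq_norm]
    exact hy1 n
  obtain ⟨b, hb0, hb⟩ := hT.exists_abs_apply_le (∑' n, |y n|)
  obtain ⟨n, hn⟩ := exists_nat_gt ‖b‖
  have h1 : ‖T (y n)‖ ≤ ‖b‖ := norm_le_norm_of_abs_le_abs (by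
    rw [abs_of_nonneg hb0]
    exact hb _ (hs.le_tsum n fun j _ => abs_nonneg (y j)))
  exact lt_irrefl _ ((hn.trans (hy2 n)).trans_le h1)

/-- An order bounded operator pulls functionals with weak* null moduli back to functionals with
weak* null positive parts. -/
theorem OrderBounded.weakStarNull_posPart_comp {T : E →L[ℝ] F}
    (hT : OrderBounded (T : E →ₗ[ℝ] F)) {f : ℕ → StrongDual ℝ F}
    (hf : WeakStarNull fun n => |f n|) : WeakStarNull fun n => ((f n).comp T)⁺ := by
  refine weakStarNull_of_nonneg fun x hx => ?_
  obtain ⟨b, -, hb⟩ := hT.exists_abs_apply_le x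
  refine squeeze_zero (fun n => posPart_nonneg ((f n).comp T) x hx) (fun n => ?_)
    (weakStarNull_iff.1 hf b)
  rw [dual_posPart_apply _ hx]
  refine supIcc_le _ hx fun u hu hux => (dual_apply_le_abs_apply (f n) (T u)).trans ?_
  have h1 := abs_nonneg (f n) _ (sub_nonneg.2 (hb u ((abs_of_nonneg hu).trans_le hux)))
  rw [zero_apply, map_sub] at h1
  exact sub_nonneg.1 h1

/-- Order bounded operators into a Banach lattice with property (d) preserve almost limited
sets. -/
theorem AlmostLimited.image [CompleteSpace E] (hF : PropertyD F) {T : E →L[ℝ] F}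
    (hT : OrderBounded (T : E →ₗ[ℝ] F)) {A : Set E} (hA : AlmostLimited A) :
    AlmostLimited (T '' A) := by
  refine ⟨T.lipschitz.isBounded_image hA.1, fun f hdisj hf => ?_⟩
  have habs := hF f hdisj hf
  have hpos := hA.tendstoUniformlyOn_of_nonneg (fun n => posPart_nonneg _)
    (hT.weakStarNull_posPart_comp habs)
  -- The negative part of `f n ∘ T` is the positive part of `-f n ∘ T`, and `-f n` has the same
  -- modulus.
  have hneg := hA.tendstoUniformlyOn_of_nonneg (fun n => posPart_nonneg _)
    (hT.weakStarNull_posPart_comp (f := fun n => -f n) (by simpa only [abs_neg] using habs))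
  rw [Metric.tendstoUniformlyOn_iff] at *
  intro ε hε
  filter_upwards [hpos (ε / 2) (by positivity), hneg (ε / 2) (by positivity)] with n h1 h2
  rintro _ ⟨x, hx, rfl⟩
  have h3 : f n (T x) = ((f n).comp T)⁺ x - ((-f n).comp T)⁺ x := by
    rw [ContinuousLinearMap.neg_comp, posPart_neg, ← sub_apply, posPart_sub_negPart]
    rfl
  have h1 := h1 x hx
  have h2 := h2 x hx
  simp only [Pi.zero_apply, dist_zero_left, Real.norm_eq_abs] at h1 h2 ⊢
  rw [h3]
  exact (abs_sub _ _).trans_lt (by linarith)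

end Operators

/-! ### Weakly null sequences. -/

theorem weaklyNull_iff {X : Type*} [NormedAddCommGroup X] [NormedSpace ℝ X] {x : ℕ → X} :
    WeaklyNull x ↔ ∀ f : StrongDual ℝ X, Tendsto (fun n => f (x n)) atTop (𝓝 0) := by
  refine (WeakBilin.tendsto_iff_forall_eval_tendsto (topDualPairing ℝ X).flip ?_).trans ?_
  · refine (injective_iff_map_eq_zero _).2 fun a ha => ?_
    exact SeparatingDual.eq_zero_of_forall_dual_eq_zero (R := ℝ) fun f => LinearMap.congr_fun ha f
  · exact forall_congr' fun f => iff_of_eq <|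
      congrArg (fun c => Tendsto (fun n => f (x n)) atTop (𝓝 c)) (map_zero f)

/-- A weakly null sequence in a relatively compact set is norm null. -/
theorem WeaklyNull.tendsto_zero {X : Type*} [NormedAddCommGroup X] [NormedSpace ℝ X] {x : ℕ → X}
    (hx : WeaklyNull x) (hc : IsCompact (closure (Set.range x))) : Tendsto x atTop (𝓝 0) := by
  refine tendsto_of_subseq_tendsto fun ns hns => ?_
  obtain ⟨a, -, φ, hφ, ha⟩ := hc.tendsto_subseq (x := fun n => x (ns n))
    fun n => subset_closure ⟨ns n, rfl⟩
  -- A norm limit is also a weak limit, so every subsequential limit is `0`.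
  have h0 : a = 0 := SeparatingDual.eq_zero_of_forall_dual_eq_zero (R := ℝ) fun f =>
    tendsto_nhds_unique ((f.continuous.tendsto a).comp ha)
      ((weaklyNull_iff.1 hx f).comp (hns.comp hφ.tendsto_atTop))
  exact ⟨φ, h0 ▸ ha⟩

theorem WeaklyNull.map {X Y : Type*} [NormedAddCommGroup X] [NormedSpace ℝ X]
    [NormedAddCommGroup Y] [NormedSpace ℝ Y] {x : ℕ → X} (hx : WeaklyNull x) (T : X →L[ℝ] Y) :
    WeaklyNull fun n => T (x n) :=
  weaklyNull_iff.2 fun f => weaklyNull_iff.1 hx (f.comp T)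

end BanachLattice

theorem mainTheorem9 {E F : Type*}
    [NormedAddCommGroup E] [NormedSpace ℝ E] [CompleteSpace E] [Lattice E] [HasSolidNorm E]
    [IsOrderedAddMonoid E] [IsOrderedModule ℝ E]
    [NormedAddCommGroup F] [NormedSpace ℝ F] [CompleteSpace F] [Lattice F] [HasSolidNorm F]
    [IsOrderedAddMonoid F] [IsOrderedModule ℝ F]
    (hE : BanachLattice.PropertyD E) (hF : BanachLattice.PropertyD F)
    (hGP : BanachLattice.StrongGelfandPhillips F)
    (T : E →ₗ[ℝ] F) (hT : BanachLattice.OrderBounded T) :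
    BanachLattice.Alcc T := by
  refine ⟨hT.continuous, fun x hx hw => ?_⟩
  let S : E →L[ℝ] F := ⟨T, hT.continuous⟩
  refine (hw.map S).tendsto_zero (hGP _ ?_)
  have := hx.image hF (T := S) hT
  rwa [← Set.range_comp] at this
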